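/- For a finite simple graph $G=(V,E)$ and $k\ge 1$, a set $S\subseteq V$ is a $k$-tuple total dominating set of $G$ if every vertex $v\in V$ (whether or not $v\in S$) has at least $k$ neighbours in $S$; the $k$-tuple total domination number $\gamma_{\times k,t}(G)$ is the minimum cardinality of such a set. Let $K_n \Box K_m$ be the Cartesian product of the complete graphs on $n$ and on $m$ vertices (the $n\times m$ rook's graph). For all integers $1\le n\le m$ with $(n,m)\notin\{(1,1),(1,2)\}$, $$ \gamma_{\times 2,t}(K_n \Box K_m)= \begin{cases} 3 & \text{if } n=1 \text{ and } m\ge 3,\\ 2n & \text{if } n\ge 2 \text{ and } m\ge \lfloor (5n-4)/3\rfloor+1,\\ \lceil 3(n+m)/4\rceil+1 & \text{if } m\le \lfloor (5n-4)/3\rfloor \text{ and } m\equiv 3n+4 \pmod 8,\\ \lceil 3(n+m)/4\rceil & \text{otherwise.} \end{cases} $$ In particular, for all integers $n\ge 2$, $$ \gamma_{\times 2,t}(K_n \Box K_n)= \begin{cases} \lceil 3n/2\rceil+1 & \text{if } n\equiv 2 \pmod 4,\\ \lceil 3n/2\rceil & \text{otherwise.} \end{cases} $$ -/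

import Mathlib

/-- `S` is a `k`-tuple total dominating set of `G`: every vertex of `G`
has at least `k` neighbours in `S`. -/
def SimpleGraph.IsTupleTotalDominating {V : Type*} (G : SimpleGraph V) (k : ℕ)
    (S : Finset V) : Prop :=
  ∀ v : V, k ≤ (G.neighborSet v ∩ (S : Set V)).ncard

/-- The `k`-tuple total domination number of a finite graph: the minimum cardinality of a
`k`-tuple total dominating set. If no such set exists the infimum takes the value `0`; for
`k ≥ 1` on a graph with a vertex, a positive value therefore is always attained by such a set. -/
noncomputable def SimpleGraph.tupleTotalDominationNumber {V : Type*} [Finite V]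
    (G : SimpleGraph V) (k : ℕ) : ℕ :=
  sInf {c : ℕ | ∃ S : Finset V, G.IsTupleTotalDominating k S ∧ S.card = c}

/-- The `n × m` rook's graph, the Cartesian product of the complete graphs on `n` and on
`m` vertices. -/
def rookGraph (n m : ℕ) : SimpleGraph (Fin n × Fin m) :=
  (SimpleGraph.completeGraph (Fin n)).boxProd (SimpleGraph.completeGraph (Fin m))

/-! A set `S` dominates iff row degree plus column degree is at least 2 off `S` and at least 4 on
`S`. If `S` misses a row or column, every line of the other direction holds two cells, so `S` has at
least `2 * n` cells; two full columns attain this. Otherwise give each cell the sum of the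
reciprocals of its two degrees. The weights total `n + m`, and each is at most 4/3, so `3 * (n + m)
≤ 4 * #S`. Equality forces disjoint claws (1×3 and 3×1 blocks), hence `m ≡ 3 * n` mod 8; when `m ≡ 3
* n + 4`, the bound is an integer but unattainable, which costs one more cell. For sharpness,
`hasDegreeSumFour_ceil` places claws and a small block depending on `m - 3 * n` mod 8 along a
diagonal. -/

open Finset

/-! ### Degree counts and the reciprocal-weight bound -/

section Degrees

variable {α β γ δ : Type*}

/-- The number of cells of `S` in row `i`. -/
def rowDegree [DecidableEq α] (S : Finset (α × β)) (i : α) : ℕ := #{p ∈ S | p.1 = i}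

/-- The number of cells of `S` in column `j`. -/
def colDegree [DecidableEq β] (S : Finset (α × β)) (j : β) : ℕ := #{p ∈ S | p.2 = j}

lemma rowDegree_pos [DecidableEq α] {S : Finset (α × β)} {p : α × β} (hp : p ∈ S) : 0 < rowDegree S p.1 :=
  card_pos.2 ⟨p, by simp [hp]⟩

lemma colDegree_pos [DecidableEq β] {S : Finset (α × β)} {p : α × β} (hp : p ∈ S) : 0 < colDegree S p.2 :=
  card_pos.2 ⟨p, by simp [hp]⟩

lemma rowDegree_mono [DecidableEq α] {S T : Finset (α × β)} (h : S ⊆ T) (i : α) :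
    rowDegree S i ≤ rowDegree T i :=
  card_le_card (filter_subset_filter _ h)

lemma colDegree_mono [DecidableEq β] {S T : Finset (α × β)} (h : S ⊆ T) (j : β) :
    colDegree S j ≤ colDegree T j :=
  card_le_card (filter_subset_filter _ h)

lemma rowDegree_map [DecidableEq α] [DecidableEq γ] (f : α ↪ γ) (g : β ↪ δ) (S : Finset (α × β)) (i : α) :
    rowDegree (S.map (f.prodMap g)) (f i) = rowDegree S i := by
  simp [rowDegree, filter_map, Function.comp_def]

lemma colDegree_map [DecidableEq β] [DecidableEq δ] (f : α ↪ γ) (g : β ↪ δ) (S : Finset (α × β)) (j : β) :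
    colDegree (S.map (f.prodMap g)) (g j) = colDegree S j := by
  simp [colDegree, filter_map, Function.comp_def]

lemma sum_rowDegree [DecidableEq α] [Fintype α] (S : Finset (α × β)) : ∑ i, rowDegree S i = #S :=
  (card_eq_sum_card_fiberwise (fun _ _ => mem_univ _)).symm

lemma sum_colDegree [DecidableEq β] [Fintype β] (S : Finset (α × β)) : ∑ j, colDegree S j = #S :=
  (card_eq_sum_card_fiberwise (fun _ _ => mem_univ _)).symm

lemma sum_inv_rowDegree [DecidableEq α] [Fintype α] {S : Finset (α × β)} (h : ∀ i, 0 < rowDegree S i) :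
    ∑ p ∈ S, (rowDegree S p.1 : ℚ)⁻¹ = Fintype.card α := by
  rw [← sum_fiberwise_of_maps_to (g := Prod.fst) (t := univ) (fun _ _ => mem_univ _)]
  have : ∀ i : α, ∑ p ∈ S with p.1 = i, (rowDegree S p.1 : ℚ)⁻¹ = 1 := by
    intro i
    rw [sum_congr rfl (g := fun _ => (rowDegree S i : ℚ)⁻¹)
      (fun p hp => by rw [(mem_filter.1 hp).2]), sum_const, nsmul_eq_mul]
    exact mul_inv_cancel₀ (Nat.cast_ne_zero.2 (h i).ne')
  simp [this]

lemma sum_inv_colDegree [DecidableEq β] [Fintype β] {S : Finset (α × β)} (h : ∀ j, 0 < colDegree S j) :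
    ∑ p ∈ S, (colDegree S p.2 : ℚ)⁻¹ = Fintype.card β := by
  rw [← sum_fiberwise_of_maps_to (g := Prod.snd) (t := univ) (fun _ _ => mem_univ _)]
  have : ∀ j : β, ∑ p ∈ S with p.2 = j, (colDegree S p.2 : ℚ)⁻¹ = 1 := by
    intro j
    rw [sum_congr rfl (g := fun _ => (colDegree S j : ℚ)⁻¹)
      (fun p hp => by rw [(mem_filter.1 hp).2]), sum_const, nsmul_eq_mul]
    exact mul_inv_cancel₀ (Nat.cast_ne_zero.2 (h j).ne')
  simp [this]

/-- Every row and column meets `S`, and at each cell of `S` the row and column degrees add up to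
at least four. -/
def IsDegreeSumFour [DecidableEq α] [DecidableEq β] (S : Finset (α × β)) : Prop :=
  (∀ i, 0 < rowDegree S i) ∧ (∀ j, 0 < colDegree S j) ∧
    ∀ p ∈ S, 4 ≤ rowDegree S p.1 + colDegree S p.2

instance [DecidableEq α] [DecidableEq β] [Fintype α] [Fintype β] (S : Finset (α × β)) : Decidable (IsDegreeSumFour S) :=
  inferInstanceAs (Decidable (_ ∧ _ ∧ _))

lemma inv_add_inv_le_four_thirds {a b : ℕ} (ha : 0 < a) (hb : 0 < b) (h : 4 ≤ a + b) :
    (a : ℚ)⁻¹ + (b : ℚ)⁻¹ ≤ 4 / 3 := by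
  have ha' : (1 : ℚ) ≤ a := by exact_mod_cast ha
  have hb' : (1 : ℚ) ≤ b := by exact_mod_cast hb
  have h' : (4 : ℚ) ≤ a + b := by exact_mod_cast h
  have : (a : ℚ)⁻¹ + (b : ℚ)⁻¹ = (a + b) / (a * b) := by field_simp; ring
  rw [this, div_le_div_iff₀ (by positivity) (by norm_num)]
  -- From `(a - 1) * (b - 1) ≥ 0`: `4ab ≥ 4(a + b) - 4 ≥ 3(a + b)`.
  nlinarith [mul_nonneg (sub_nonneg.2 ha') (sub_nonneg.2 hb')]

lemma eq_one_three_of_inv_add_inv_eq {a b : ℕ} (ha : 0 < a) (hb : 0 < b) (h : 4 ≤ a + b)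
    (he : (a : ℚ)⁻¹ + (b : ℚ)⁻¹ = 4 / 3) : (a = 1 ∧ b = 3) ∨ (a = 3 ∧ b = 1) := by
  have ha' : (a : ℚ) ≠ 0 := by positivity
  have hb' : (b : ℚ) ≠ 0 := by positivity
  field_simp at he
  have he' : 3 * (a + b) = 4 * (a * b) := by
    have : (3 * (a + b) : ℚ) = 4 * (a * b) := by linarith
    exact_mod_cast this
  have ha2 : a = 1 ∨ b = 1 := by
    by_contra! hc
    have : 2 ≤ a := by omega
    have : 2 ≤ b := by omega
    nlinarith
  rcases ha2 with rfl | rfl <;> omega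

variable [DecidableEq α] [DecidableEq β] [Fintype α] [Fintype β] {S : Finset (α × β)}

lemma IsDegreeSumFour.three_mul_card_add_card_le (hS : IsDegreeSumFour S) :
    3 * (Fintype.card α + Fintype.card β) ≤ 4 * #S := by
  have h := sum_le_sum fun p hp => inv_add_inv_le_four_thirds (rowDegree_pos hp)
    (colDegree_pos hp) (hS.2.2 p hp)
  rw [sum_add_distrib, sum_inv_rowDegree hS.1, sum_inv_colDegree hS.2.1, sum_const,
    nsmul_eq_mul] at h
  have : (3 * (Fintype.card α + Fintype.card β) : ℚ) ≤ 4 * #S := by linarith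
  exact_mod_cast this

/-- In the extremal case `S` is a disjoint union of claws, `a` of which are centred at columns. -/
lemma IsDegreeSumFour.exists_card_add_eq (hS : IsDegreeSumFour S)
    (h : 4 * #S = 3 * (Fintype.card α + Fintype.card β)) :
    ∃ a, Fintype.card β + 8 * a = 3 * Fintype.card α := by
  have hle : ∀ p ∈ S, (rowDegree S p.1 : ℚ)⁻¹ + (colDegree S p.2 : ℚ)⁻¹ ≤ 4 / 3 :=
    fun p hp => inv_add_inv_le_four_thirds (rowDegree_pos hp) (colDegree_pos hp) (hS.2.2 p hp)
  have hsum : ∑ p ∈ S, ((rowDegree S p.1 : ℚ)⁻¹ + (colDegree S p.2 : ℚ)⁻¹)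
      = ∑ p ∈ S, (4 / 3 : ℚ) := by
    rw [sum_add_distrib, sum_inv_rowDegree hS.1, sum_inv_colDegree hS.2.1, sum_const,
      nsmul_eq_mul]
    have : (4 * #S : ℚ) = 3 * (Fintype.card α + Fintype.card β) := by exact_mod_cast h
    linarith
  have hdeg : ∀ p ∈ S, (rowDegree S p.1 = 1 ∧ colDegree S p.2 = 3) ∨
      (rowDegree S p.1 = 3 ∧ colDegree S p.2 = 1) := fun p hp =>
    eq_one_three_of_inv_add_inv_eq (rowDegree_pos hp) (colDegree_pos hp) (hS.2.2 p hp)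
      ((sum_eq_sum_iff_of_le hle).1 hsum p hp)
  have key : (Fintype.card α : ℚ) = #{p ∈ S | rowDegree S p.1 = 1}
      + #{p ∈ S | ¬ rowDegree S p.1 = 1} / 3 := by
    rw [← sum_inv_rowDegree hS.1, ← sum_filter_add_sum_filter_not S (fun p => rowDegree S p.1 = 1)]
    congr 1
    · rw [sum_congr rfl (g := fun _ => (1 : ℚ)) (fun p hp => by simp [(mem_filter.1 hp).2])]
      simp
    · rw [sum_congr rfl (g := fun _ => (1 / 3 : ℚ)), sum_const, nsmul_eq_mul]
      · ring
      · intro p hp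
        have hp := mem_filter.1 hp
        have : rowDegree S p.1 = 3 := by have := hdeg p hp.1; omega
        simp [this]
  have hc := card_filter_add_card_filter_not (s := S) (fun p => rowDegree S p.1 = 1)
  have key' : 3 * Fintype.card α = 3 * #{p ∈ S | rowDegree S p.1 = 1}
      + #{p ∈ S | ¬ rowDegree S p.1 = 1} := by
    have : (3 * Fintype.card α : ℚ) = 3 * #{p ∈ S | rowDegree S p.1 = 1}
      + #{p ∈ S | ¬ rowDegree S p.1 = 1} := by linarith
    exact_mod_cast this
  -- With `x` cells of row degree 1, the counts give `9n = 8x + 3m`, so 3 divides `x` and the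
  -- division is exact.
  refine ⟨#{p ∈ S | rowDegree S p.1 = 1} / 3, ?_⟩
  omega

end Degrees

/-! ### Block-diagonal constructions -/

/-- Some `e` cells of the `n × m` board satisfy `IsDegreeSumFour`. -/
def HasDegreeSumFour (n m e : ℕ) : Prop :=
  ∃ S : Finset (Fin n × Fin m), IsDegreeSumFour S ∧ #S = e

/-- Boards placed diagonally share no row or column, so degrees do not drop. -/
lemma HasDegreeSumFour.add {n m e n' m' e' : ℕ} (h : HasDegreeSumFour n m e)
    (h' : HasDegreeSumFour n' m' e') : HasDegreeSumFour (n + n') (m + m') (e + e') := by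
  obtain ⟨S, ⟨hr, hc, hS⟩, rfl⟩ := h
  obtain ⟨T, ⟨hr', hc', hT⟩, rfl⟩ := h'
  set A := S.map ((Fin.castAddEmb n').prodMap (Fin.castAddEmb m')) with hA
  set B := T.map ((Fin.natAddEmb n).prodMap (Fin.natAddEmb m)) with hB
  have rA : ∀ i, rowDegree S i ≤ rowDegree (A ∪ B) (Fin.castAdd n' i) := fun i =>
    (rowDegree_map (Fin.castAddEmb n') (Fin.castAddEmb m') S i).symm.le.trans
      (rowDegree_mono subset_union_left _)
  have cA : ∀ j, colDegree S j ≤ colDegree (A ∪ B) (Fin.castAdd m' j) := fun j =>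
    (colDegree_map (Fin.castAddEmb n') (Fin.castAddEmb m') S j).symm.le.trans
      (colDegree_mono subset_union_left _)
  have rB : ∀ i, rowDegree T i ≤ rowDegree (A ∪ B) (Fin.natAdd n i) := fun i =>
    (rowDegree_map (Fin.natAddEmb n) (Fin.natAddEmb m) T i).symm.le.trans
      (rowDegree_mono subset_union_right _)
  have cB : ∀ j, colDegree T j ≤ colDegree (A ∪ B) (Fin.natAdd m j) := fun j =>
    (colDegree_map (Fin.natAddEmb n) (Fin.natAddEmb m) T j).symm.le.trans
      (colDegree_mono subset_union_right _)
  refine ⟨A ∪ B, ⟨?_, ?_, ?_⟩, ?_⟩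
  · intro i
    induction i using Fin.addCases with
    | left i => exact (hr i).trans_le (rA i)
    | right i => exact (hr' i).trans_le (rB i)
  · intro j
    induction j using Fin.addCases with
    | left j => exact (hc j).trans_le (cA j)
    | right j => exact (hc' j).trans_le (cB j)
  · intro p hp
    rcases mem_union.1 hp with hp | hp
    · obtain ⟨q, hq, rfl⟩ := mem_map.1 hp
      exact (hS q hq).trans (add_le_add (rA _) (cA _))
    · obtain ⟨q, hq, rfl⟩ := mem_map.1 hp
      exact (hT q hq).trans (add_le_add (rB _) (cB _))
  · rw [card_union_of_disjoint, card_map, card_map]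
    rw [disjoint_left]
    intro p hp hp'
    obtain ⟨q, -, rfl⟩ := mem_map.1 hp
    obtain ⟨q', -, h⟩ := mem_map.1 hp'
    have h := congrArg (fun x => (x.1 : ℕ)) h
    have := q.1.isLt
    simp at h
    omega

lemma hasDegreeSumFour_zero : HasDegreeSumFour 0 0 0 := ⟨∅, by decide, rfl⟩

lemma hasDegreeSumFour_one_three : HasDegreeSumFour 1 3 3 := ⟨univ, by decide, by decide⟩

lemma hasDegreeSumFour_three_one : HasDegreeSumFour 3 1 3 := ⟨univ, by decide, by decide⟩

lemma hasDegreeSumFour_two_two : HasDegreeSumFour 2 2 4 := ⟨univ, by decide, by decide⟩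

lemma hasDegreeSumFour_one_four : HasDegreeSumFour 1 4 4 := ⟨univ, by decide, by decide⟩

lemma hasDegreeSumFour_four_one : HasDegreeSumFour 4 1 4 := ⟨univ, by decide, by decide⟩

lemma hasDegreeSumFour_three_three : HasDegreeSumFour 3 3 5 :=
  ⟨univ.filter fun p => p.1 = 0 ∨ p.2 = 0, by decide, by decide⟩

lemma hasDegreeSumFour_three_four : HasDegreeSumFour 3 4 6 :=
  ⟨univ.filter fun p => p.1 = 0 ∨ p.2 = 0, by decide, by decide⟩

lemma hasDegreeSumFour_four_three : HasDegreeSumFour 4 3 6 :=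
  ⟨univ.filter fun p => p.1 = 0 ∨ p.2 = 0, by decide, by decide⟩

lemma HasDegreeSumFour.add_claws {n m e : ℕ} (h : HasDegreeSumFour n m e) (a b : ℕ) :
    HasDegreeSumFour (n + a + 3 * b) (m + 3 * a + b) (e + 3 * a + 3 * b) := by
  induction b with
  | zero =>
    induction a with
    | zero => exact h
    | succ a ih => exact ih.add hasDegreeSumFour_one_three
  | succ b ih => exact ih.add hasDegreeSumFour_three_one

/-- Blocks of size `p × q` with `f` cells extend to all larger boards of the right residue that
are not too elongated. -/
lemma HasDegreeSumFour.extend {p q f n m e : ℕ} (h : HasDegreeSumFour p q f)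
    (h₁ : m + 3 * p ≤ 3 * n + q) (h₂ : n + 3 * q ≤ 3 * m + p)
    (hmod : (3 * n + q) % 8 = (m + 3 * p) % 8) (he : 4 * (e - f) + 3 * (p + q) = 3 * (n + m))
    (hf : f ≤ e) : HasDegreeSumFour n m e := by
  -- The numbers of claws solve `n = p + a + 3b`, `m = q + 3a + b`.
  have := h.add_claws ((3 * m + p - (n + 3 * q)) / 8) ((3 * n + q - (m + 3 * p)) / 8)
  convert this using 1 <;> omega

lemma hasDegreeSumFour_ceil {n m : ℕ} (hnm : n ≤ m) (hn : 2 ≤ n) (h : 3 * m + 4 ≤ 5 * n) :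
    HasDegreeSumFour n m
      ((3 * (n + m) + 3) / 4 + if m % 8 = (3 * n + 4) % 8 then 1 else 0) := by
  obtain ⟨r, hr, h'⟩ : ∃ r < 8, m % 8 = (3 * n + r) % 8 := ⟨(m + 5 * n) % 8, by omega, by omega⟩
  interval_cases r
  · rw [if_neg (by omega)]
    apply hasDegreeSumFour_zero.extend <;> omega
  · rw [if_neg (by omega)]
    apply hasDegreeSumFour_one_four.extend <;> omega
  · rw [if_neg (by omega)]
    apply hasDegreeSumFour_three_three.extend <;> omega
  · rw [if_neg (by omega)]
    apply hasDegreeSumFour_three_four.extend <;> omega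
  · rw [if_pos h']
    apply hasDegreeSumFour_two_two.extend <;> omega
  · rw [if_neg (by omega)]
    apply hasDegreeSumFour_four_one.extend <;> omega
  · rw [if_neg (by omega)]
    -- The residue makes `3n - m` congruent to 2 mod 8, and `h` excludes the value 2, leaving room
    -- for the 5×5 block.
    obtain ⟨k, hk⟩ : ∃ k, m + 10 + 8 * k = 3 * n := ⟨(3 * n - 10 - m) / 8, by omega⟩
    apply (hasDegreeSumFour_one_four.add hasDegreeSumFour_four_one).extend <;> omega
  · rw [if_neg (by omega)]
    apply hasDegreeSumFour_four_three.extend <;> omega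

/-! ### Domination in the rook's graph -/

lemma rookGraph_adj {n m : ℕ} (v w : Fin n × Fin m) :
    (rookGraph n m).Adj v w ↔ (v.1 ≠ w.1 ∧ v.2 = w.2) ∨ (v.2 ≠ w.2 ∧ v.1 = w.1) := by
  simp [rookGraph, SimpleGraph.boxProd_adj]

/-- A cell of `S` is counted in both its row and its column but is not its own neighbour, hence the
correction by 2. -/
lemma ncard_neighborSet_inter {n m : ℕ} (S : Finset (Fin n × Fin m)) (v : Fin n × Fin m) :
    ((rookGraph n m).neighborSet v ∩ (S : Set (Fin n × Fin m))).ncard + (if v ∈ S then 2 else 0)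
      = rowDegree S v.1 + colDegree S v.2 := by
  have h : (rookGraph n m).neighborSet v ∩ (S : Set (Fin n × Fin m)) =
      ((({p ∈ S | p.1 = v.1} : Finset _).erase v ∪ ({p ∈ S | p.2 = v.2} : Finset _).erase v :
        Finset (Fin n × Fin m)) : Set (Fin n × Fin m)) := by
    ext ⟨i, j⟩
    obtain ⟨a, b⟩ := v
    simp only [Set.mem_inter_iff, SimpleGraph.mem_neighborSet, rookGraph_adj, mem_coe, mem_union,
      mem_erase, mem_filter, ne_eq, Prod.mk.injEq]
    grind
  have hd : Disjoint (({p ∈ S | p.1 = v.1} : Finset _).erase v)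
      (({p ∈ S | p.2 = v.2} : Finset _).erase v) := by
    rw [disjoint_left]
    intro p hp hp'
    simp only [mem_erase, mem_filter] at hp hp'
    exact hp.1 (Prod.ext hp.2.2 hp'.2.2)
  rw [h, Set.ncard_coe_finset, card_union_of_disjoint hd]
  by_cases hv : v ∈ S
  · have h₁ := card_erase_add_one (s := {p ∈ S | p.1 = v.1}) (a := v) (by simp [hv])
    have h₂ := card_erase_add_one (s := {p ∈ S | p.2 = v.2}) (a := v) (by simp [hv])
    rw [if_pos hv, rowDegree, colDegree]
    omega
  · rw [erase_eq_of_notMem (by simp [hv]), erase_eq_of_notMem (by simp [hv]), if_neg hv]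
    rfl

lemma isTupleTotalDominating_two_iff {n m : ℕ} (S : Finset (Fin n × Fin m)) :
    (rookGraph n m).IsTupleTotalDominating 2 S ↔
      ∀ v, 2 + (if v ∈ S then 2 else 0) ≤ rowDegree S v.1 + colDegree S v.2 := by
  refine forall_congr' fun v => ?_
  rw [← ncard_neighborSet_inter S v]
  exact (Nat.add_le_add_iff_right).symm

lemma SimpleGraph.tupleTotalDominationNumber_eq {V : Type*} [Finite V] {G : SimpleGraph V}
    {k c : ℕ} (h : ∃ S : Finset V, G.IsTupleTotalDominating k S ∧ #S = c)
    (h' : ∀ S : Finset V, G.IsTupleTotalDominating k S → c ≤ #S) :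
    G.tupleTotalDominationNumber k = c := by
  refine le_antisymm (Nat.sInf_le h) (le_csInf ⟨c, h⟩ ?_)
  rintro _ ⟨S, hS, rfl⟩
  exact h' S hS

lemma IsDegreeSumFour.isTupleTotalDominating {n m : ℕ} {S : Finset (Fin n × Fin m)}
    (hS : IsDegreeSumFour S) : (rookGraph n m).IsTupleTotalDominating 2 S := by
  rw [isTupleTotalDominating_two_iff]
  intro v
  have h₁ := hS.1 v.1
  have h₂ := hS.2.1 v.2
  split_ifs with hv
  · exact hS.2.2 v hv
  · omega

/-- A dominating set that misses a row or a column has two cells in every column or row. -/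
lemma isDegreeSumFour_or_two_mul_le {n m : ℕ} (hnm : n ≤ m) {S : Finset (Fin n × Fin m)}
    (hS : (rookGraph n m).IsTupleTotalDominating 2 S) : IsDegreeSumFour S ∨ 2 * n ≤ #S := by
  rw [isTupleTotalDominating_two_iff] at hS
  by_cases hr : ∀ i, 0 < rowDegree S i
  · by_cases hc : ∀ j, 0 < colDegree S j
    · exact .inl ⟨hr, hc, fun p hp => by simpa [hp] using hS p⟩
    · push Not at hc
      obtain ⟨j, hj⟩ := hc
      right
      rw [← sum_rowDegree S]
      calc 2 * n = ∑ i : Fin n, 2 := by simp [mul_comm]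
        _ ≤ _ := sum_le_sum fun i _ => by have := hS (i, j); simp only at this; omega
  · push Not at hr
    obtain ⟨i, hi⟩ := hr
    right
    rw [← sum_colDegree S]
    calc 2 * n ≤ 2 * m := by omega
      _ = ∑ j : Fin m, 2 := by simp [mul_comm]
      _ ≤ _ := sum_le_sum fun j _ => by have := hS (i, j); simp only at this; omega

lemma min_le_card_of_isTupleTotalDominating {n m : ℕ} (hnm : n ≤ m) {S : Finset (Fin n × Fin m)}
    (hS : (rookGraph n m).IsTupleTotalDominating 2 S) :
    min (2 * n) ((3 * (n + m) + 3) / 4 + if m % 8 = (3 * n + 4) % 8 then 1 else 0) ≤ #S := by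
  rcases isDegreeSumFour_or_two_mul_le hnm hS with h | h
  · refine (min_le_right _ _).trans ?_
    have h₁ := h.three_mul_card_add_card_le
    have h₂ := h.exists_card_add_eq
    simp only [Fintype.card_fin] at h₁ h₂
    split_ifs with hm
    · by_contra hlt
      obtain ⟨a, ha⟩ := h₂ (by omega)
      omega
    · omega
  · exact (min_le_left _ _).trans h

lemma exists_isTupleTotalDominating_card_two_mul {n m : ℕ} (hn : 2 ≤ n) (hm : 2 ≤ m) :
    ∃ S, (rookGraph n m).IsTupleTotalDominating 2 S ∧ #S = 2 * n := by
  obtain ⟨s, -, hs⟩ := exists_subset_card_eq (s := (univ : Finset (Fin m))) (n := 2)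
    (by simpa using hm)
  refine ⟨(univ : Finset (Fin n)) ×ˢ s, ?_, by rw [card_product, hs, card_univ, Fintype.card_fin, mul_comm]⟩
  rw [isTupleTotalDominating_two_iff]
  intro v
  have h₁ : 2 ≤ rowDegree ((univ : Finset (Fin n)) ×ˢ s) v.1 := by
    rw [← hs, ← card_map ⟨fun j => (v.1, j), Prod.mk_right_injective _⟩]
    refine card_le_card fun p hp => ?_
    obtain ⟨j, hj, rfl⟩ := mem_map.1 hp
    simpa using hj
  split_ifs with hv
  · have h₂ : #(univ : Finset (Fin n)) ≤ colDegree ((univ : Finset (Fin n)) ×ˢ s) v.2 := by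
      rw [← card_map ⟨fun i => (i, v.2), Prod.mk_left_injective _⟩]
      refine card_le_card fun p hp => ?_
      obtain ⟨i, -, rfl⟩ := mem_map.1 hp
      simpa using hv
    rw [card_univ, Fintype.card_fin] at h₂
    omega
  · omega

/-- On a single row the row degree is `#S` and column degrees are at most 1, so a cell of `S` needs
`#S + 1 ≥ 4`. -/
lemma tupleTotalDominationNumber_rookGraph_one {m : ℕ} (hm : 3 ≤ m) :
    (rookGraph 1 m).tupleTotalDominationNumber 2 = 3 := by
  have hrow : ∀ (S : Finset (Fin 1 × Fin m)) i, rowDegree S i = #S := fun S i => by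
    rw [rowDegree, filter_true_of_mem fun p _ => Subsingleton.elim _ _]
  have hcol : ∀ (S : Finset (Fin 1 × Fin m)) j, colDegree S j ≤ 1 := fun S j =>
    card_le_one.2 fun p hp q hq =>
      Prod.ext (Subsingleton.elim _ _) ((mem_filter.1 hp).2.trans (mem_filter.1 hq).2.symm)
  apply SimpleGraph.tupleTotalDominationNumber_eq
  · obtain ⟨S, -, hS⟩ := exists_subset_card_eq (s := (univ : Finset (Fin 1 × Fin m))) (n := 3)
      (by simpa using hm)
    refine ⟨S, ?_, hS⟩
    rw [isTupleTotalDominating_two_iff]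
    intro v
    rw [hrow, hS]
    split_ifs with hv
    · have := colDegree_pos hv
      omega
    · omega
  · intro S hS
    rw [isTupleTotalDominating_two_iff] at hS
    have hne : S.Nonempty := by
      rw [nonempty_iff_ne_empty]
      rintro rfl
      have := hS (0, ⟨0, by omega⟩)
      simp [rowDegree, colDegree] at this
    obtain ⟨v, hv⟩ := hne
    have h₁ := hS v
    have h₂ := hcol S v.2
    rw [hrow, if_pos hv] at h₁
    omega

/-- The threshold is exact: `5 * n < 3 * m + 4` iff `2 * n ≤ (3 * (n + m) + 3) / 4`. When it fails,
the rounded bound is below `2 * n`, so adding 1 cannot exceed `2 * n`. -/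
lemma tupleTotalDominationNumber_rookGraph {n m : ℕ} (hn : 2 ≤ n) (hnm : n ≤ m) :
    (rookGraph n m).tupleTotalDominationNumber 2 =
      if 5 * n < 3 * m + 4 then 2 * n
      else (3 * (n + m) + 3) / 4 + if m % 8 = (3 * n + 4) % 8 then 1 else 0 := by
  split_ifs with h h'
  · refine SimpleGraph.tupleTotalDominationNumber_eq
      (exists_isTupleTotalDominating_card_two_mul hn (hn.trans hnm)) fun S hS => ?_
    have := min_le_card_of_isTupleTotalDominating hnm hS
    split_ifs at this <;> omega
  all_goals
    obtain ⟨S, hS, hcard⟩ := hasDegreeSumFour_ceil hnm hn (by omega)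
    refine SimpleGraph.tupleTotalDominationNumber_eq ⟨S, hS.isTupleTotalDominating,
      by simpa [h'] using hcard⟩ fun S hS => ?_
    have := min_le_card_of_isTupleTotalDominating hnm hS
    simp only [h', if_true, if_false] at this
    omega

lemma natCeil_div_four (a : ℕ) : ⌈(a : ℚ) / 4⌉₊ = (a + 3) / 4 := by
  apply eq_of_forall_ge_iff
  intro c
  rw [Nat.ceil_le, div_le_iff₀ (by norm_num)]
  have : (a : ℚ) ≤ c * 4 ↔ a ≤ c * 4 := by exact_mod_cast Iff.rfl
  rw [this]
  omega

lemma floor_five_mul_sub_four_div_three_lt_iff (n m : ℕ) :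
    ⌊(5 * (n : ℚ) - 4) / 3⌋ < (m : ℤ) ↔ 5 * n < 3 * m + 4 := by
  rw [Int.floor_lt, div_lt_iff₀ (by norm_num), sub_lt_iff_lt_add, Int.cast_natCast, mul_comm (m : ℚ)]
  exact_mod_cast Iff.rfl

theorem mainTheorem1 :
    (∀ n m : ℕ, 1 ≤ n → n ≤ m → (n, m) ≠ (1, 1) → (n, m) ≠ (1, 2) →
      (rookGraph n m).tupleTotalDominationNumber 2 =
        if n = 1 ∧ 3 ≤ m then 3
        else if 2 ≤ n ∧ ⌊(5 * (n : ℚ) - 4) / 3⌋ + 1 ≤ (m : ℤ) then 2 * n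
        else if (m : ℤ) ≤ ⌊(5 * (n : ℚ) - 4) / 3⌋ ∧ m ≡ 3 * n + 4 [MOD 8] then
          ⌈3 * ((n : ℚ) + (m : ℚ)) / 4⌉₊ + 1
        else ⌈3 * ((n : ℚ) + (m : ℚ)) / 4⌉₊) ∧
    (∀ n : ℕ, 2 ≤ n →
      (rookGraph n n).tupleTotalDominationNumber 2 =
        if n ≡ 2 [MOD 4] then ⌈3 * (n : ℚ) / 2⌉₊ + 1
        else ⌈3 * (n : ℚ) / 2⌉₊) := by
  have main : ∀ n m : ℕ, 1 ≤ n → n ≤ m → (n, m) ≠ (1, 1) → (n, m) ≠ (1, 2) →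
      (rookGraph n m).tupleTotalDominationNumber 2 =
        if n = 1 ∧ 3 ≤ m then 3
        else if 2 ≤ n ∧ ⌊(5 * (n : ℚ) - 4) / 3⌋ + 1 ≤ (m : ℤ) then 2 * n
        else if (m : ℤ) ≤ ⌊(5 * (n : ℚ) - 4) / 3⌋ ∧ m ≡ 3 * n + 4 [MOD 8] then
          ⌈3 * ((n : ℚ) + (m : ℚ)) / 4⌉₊ + 1
        else ⌈3 * ((n : ℚ) + (m : ℚ)) / 4⌉₊ := by
    intro n m hn hnm h₁ h₂
    have hceil : ⌈3 * ((n : ℚ) + (m : ℚ)) / 4⌉₊ = (3 * (n + m) + 3) / 4 := by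
      exact_mod_cast natCeil_div_four (3 * (n + m))
    have hfloor := floor_five_mul_sub_four_div_three_lt_iff n m
    have hmod : m ≡ 3 * n + 4 [MOD 8] ↔ m % 8 = (3 * n + 4) % 8 := Iff.rfl
    simp only [hceil, hmod]
    rcases hn.eq_or_lt with rfl | hn
    · have hm : 3 ≤ m := by
        by_contra hlt
        obtain rfl | rfl : m = 1 ∨ m = 2 := by omega
        · exact h₁ rfl
        · exact h₂ rfl
      rw [if_pos ⟨rfl, hm⟩, tupleTotalDominationNumber_rookGraph_one hm]
    · rw [tupleTotalDominationNumber_rookGraph hn hnm]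
      generalize ⌊(5 * (n : ℚ) - 4) / 3⌋ = f at hfloor ⊢
      split_ifs <;> omega
  refine ⟨main, fun n hn => ?_⟩
  have hceil : ⌈3 * (n : ℚ) / 2⌉₊ = (3 * (n + n) + 3) / 4 := by
    rw [← natCeil_div_four]
    congr 1
    push_cast
    ring
  rw [tupleTotalDominationNumber_rookGraph hn le_rfl, hceil]
  simp only [show n ≡ 2 [MOD 4] ↔ n % 4 = 2 from Iff.rfl]
  split_ifs <;> omega
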